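/- Let $L>0$. Let $a:(0,L)\to\mathbb R$ be measurable with $\alpha\le a\le\beta$ a.e. for some $0<\alpha<\beta$, let $g\in L^2(0,L)$, and let $\phi:\mathbb R\to\mathbb R\cup\{+\infty\}$ be continuous (with values in $\mathbb R\cup\{+\infty\}$) with $\phi(s)<+\infty$ for $s\neq0$ and $\phi(0)=+\infty$. For $n\in\mathbb N$ let $a_n$ be measurable on $(0,L)$ with $\alpha'\le a_n\le\beta'$ a.e., where $0<\alpha'<\beta'$ do not depend on $n$, and $a_n\to a$ a.e. in $(0,L)$; let $g_n$ be a bounded sequence in $L^2(0,L)$ with $g_n\rightharpoonup g$ weakly in $L^2(0,L)$; and let $\phi_n:\mathbb R\to\mathbb R$ be continuous functions such that $\phi_n(s_n)\to\phi(s)$ in $\mathbb R\cup\{+\infty\}$ whenever $s_n\to s$ in $\mathbb R$. Let $u_n\in H^1_0(0,L)$ satisfy $$\int_0^L a_n u_n' z'\,dx=\int_0^L\phi_n(u_n)z'\,dx+\int_0^L g_n z'\,dx\qquad\text{for all } z\in H^1_0(0,L).$$ Elements of $H^1_0(0,L)$ are identified with their continuous representatives on $[0,L]$. Then for every $n$ there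 is a unique constant $c_n\in\mathbb R$ with $a_n u_n'=\phi_n(u_n)+g_n+c_n$ in $\mathcal D'(0,L)$. Moreover, if along a subsequence $(n'')$ one has $u_{n''}\rightharpoonup u$ weakly in $H^1_0(0,L)$ and $c_{n''}\to\tilde c$ in $\mathbb R\cup\{\pm\infty\}$, then: 1. The following are equivalent: $u=0$; $\tilde c=-\infty$; for every $M\in\mathbb R$, for all $n''$ sufficiently large, $\phi_{n''}(u_{n''}(x))\ge M$ for all $x\in(0,L)$; $\phi_{n''}(u_{n''})\to+\infty$ uniformly on $[0,L]$. 2. The following are equivalent: $u\neq0$; $-\infty<\tilde c<+\infty$; $\phi(u)\in L^2(0,L)$ and $\phi_{n''}(u_{n''})\rightharpoonup\phi(u)$ weakly in $L^2(0,L)$. 3. $\tilde c\neq+\infty$. -/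

import Mathlib

open MeasureTheory Filter Set
open scoped Topology Distributions

namespace SingularODE

/-- Lebesgue measure on the open interval `(0, L)`. -/
noncomputable def mu (L : ℝ) : Measure ℝ := volume.restrict (Ioo 0 L)

/-- The open interval `(0, L)`, as an open set carrying the test functions `C_c^∞(0, L)`. -/
def interval (L : ℝ) : TopologicalSpace.Opens ℝ := ⟨Ioo 0 L, isOpen_Ioo⟩

/-- `f = h` in the sense of distributions on `(0, L)`. -/
def EqDistrib (L : ℝ) (f h : ℝ → ℝ) : Prop :=
  ∀ ψ : 𝓓(interval L, ℝ), ∫ x, f x * ψ x ∂(mu L) = ∫ x, h x * ψ x ∂(mu L)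

/-- `z` (through its continuous representative on `[0, L]`) belongs to `H^1_0(0, L)` and `dz` is
its distributional derivative: `z` is continuous on `[0, L]` and vanishes at both end points,
`dz ∈ L^2(0, L)`, and `∫ z ψ' = - ∫ dz ψ` for every `ψ ∈ C_c^∞(0, L)`. -/
structure IsH10 (L : ℝ) (z dz : ℝ → ℝ) : Prop where
  continuousOn : ContinuousOn z (Icc 0 L)
  left : z 0 = 0
  right : z L = 0
  memLp : MemLp dz 2 (mu L)
  weakDeriv : ∀ ψ : 𝓓(interval L, ℝ),
    ∫ x, z x * deriv ψ x ∂(mu L) = - ∫ x, dz x * ψ x ∂(mu L)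

/-- Weak convergence in `L^2(0, L)`. -/
def WeakTendstoL2 (L : ℝ) (f : ℕ → ℝ → ℝ) (f₀ : ℝ → ℝ) : Prop :=
  (∀ k, MemLp (f k) 2 (mu L)) ∧ MemLp f₀ 2 (mu L) ∧
    ∀ w : ℝ → ℝ, MemLp w 2 (mu L) →
      Tendsto (fun k => ∫ x, f k x * w x ∂(mu L)) atTop (𝓝 (∫ x, f₀ x * w x ∂(mu L)))

/-- Weak convergence in `L^2(0, L)` to an extended-real valued function `F`; this requires that
`F` is an element of `L^2(0, L)`, in particular that it is finite almost everywhere. -/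
def WeakTendstoL2Ext (L : ℝ) (f : ℕ → ℝ → ℝ) (F : ℝ → EReal) : Prop :=
  (∀ᵐ x ∂(mu L), F x ≠ ⊤ ∧ F x ≠ ⊥) ∧ WeakTendstoL2 L f (fun x => (F x).toReal)

/-- Weak convergence in the Hilbert space `H^1_0(0, L)`, whose inner product is `∫ u' z'`, of
functions `u k` to `u₀`; `du k` and `du₀` are the distributional derivatives. -/
def WeakTendstoH10 (L : ℝ) (u du : ℕ → ℝ → ℝ) (u₀ du₀ : ℝ → ℝ) : Prop :=
  (∀ k, IsH10 L (u k) (du k)) ∧ IsH10 L u₀ du₀ ∧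
    ∀ z dz : ℝ → ℝ, IsH10 L z dz →
      Tendsto (fun k => ∫ x, du k x * dz x ∂(mu L)) atTop (𝓝 (∫ x, du₀ x * dz x ∂(mu L)))

/-- `a` is measurable on `(0, L)` and `α ≤ a ≤ β` almost everywhere there, with `0 < α < β`
(so `a ∈ L^∞(0, L)`). -/
structure IsCoefficient (L α β : ℝ) (a : ℝ → ℝ) : Prop where
  pos : 0 < α
  lt : α < β
  meas : AEStronglyMeasurable a (mu L)
  bounds : ∀ᵐ x ∂(mu L), α ≤ a x ∧ a x ≤ β

/-- `φ : ℝ → ℝ ∪ {+∞}` is continuous, and finite away from `0`. -/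
structure IsNonlinearity (φ : ℝ → EReal) : Prop where
  ne_bot : ∀ s, φ s ≠ ⊥
  continuous : Continuous φ
  finite : ∀ s, s ≠ 0 → φ s ≠ ⊤

/-- `φn` is a reasonable sequence of approximations of `φ`. -/
structure IsReasonableApprox (φn : ℕ → ℝ → EReal) (φ : ℝ → EReal) : Prop where
  nonlinearity : ∀ n, IsNonlinearity (φn n)
  tendsto : ∀ (s : ℕ → ℝ) (s₀ : ℝ), Tendsto s atTop (𝓝 s₀) →
    Tendsto (fun n => φn n (s n)) atTop (𝓝 (φ s₀))

/-- `u`, with distributional derivative `du`, is a weak solution of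
`-(a u')' = -(φ(u))' - g'` in `(0, L)`, `u(0) = u(L) = 0`, for a real-valued continuous `φ`:
the variational formulation with test functions in `H^1_0(0, L)`. -/
def IsWeakSolution (L : ℝ) (a g φ u du : ℝ → ℝ) : Prop :=
  IsH10 L u du ∧ ∀ z dz : ℝ → ℝ, IsH10 L z dz →
    ∫ x, a x * du x * dz x ∂(mu L) =
      ∫ x, φ (u x) * dz x ∂(mu L) + ∫ x, g x * dz x ∂(mu L)

end SingularODE

namespace SingularODE

/-! Everything follows from the flux identity `φ_n(u_n) + c_n = a_n u_n' - g_n`, whose right side is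
bounded in `L²` by some `K` independent of `n`. Integrated over an interval of length `ℓ`, it ties
`c_n` to `φ_n(u_n)`: a lower bound `M` for `φ_n(u_n)` there gives `c_n ≤ K/√ℓ - M`
(`le_of_forall_add_le`), an upper bound `M` gives `c_n ≥ -K/√ℓ - M` (`le_of_forall_le_add`).

Weak convergence in `H^1_0` gives pointwise convergence and a uniform Hölder bound, so `φ_n(u_n) →
φ(u)` in the extended reals, jointly in `n` and the point. As `φ` avoids `-∞`, compactness bounds
`φ_n(u_n)` below, so `c_n` cannot tend to `+∞`. If `u = 0`, the limit is `+∞` everywhere,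
compactness makes the divergence uniform, and `c_n → -∞`. If `u(x) ≠ 0`, then `φ_n(u_n)` is bounded
above near `x`, and `c_n` is bounded below. When `c_n` has a finite limit, `φ_n(u_n)` is bounded in
`L²` and converges pointwise, hence weakly (`weakTendstoL2Ext_of_ae`); a limit in `L²` excludes `u =
0` because `φ(0) = +∞`. -/

instance (L : ℝ) : IsFiniteMeasure (mu L) := by unfold mu; infer_instance

lemma mu_ne_zero {L : ℝ} (hL : 0 < L) : mu L ≠ 0 := by
  rw [mu, Ne, Measure.restrict_eq_zero]
  simp [hL]

lemma integral_mu {L : ℝ} (hL : 0 < L) (f : ℝ → ℝ) :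
    ∫ x, f x ∂(mu L) = ∫ x in (0 : ℝ)..L, f x := by
  rw [intervalIntegral.integral_of_le hL.le, integral_Ioc_eq_integral_Ioo, mu]

lemma ae_mu_iff {L : ℝ} {p : ℝ → Prop} : (∀ᵐ x ∂(mu L), p x) ↔ ∀ᵐ x, x ∈ Ioo 0 L → p x := by
  rw [mu, ae_restrict_iff' measurableSet_Ioo]

lemma intervalIntegrable_of_integrable {L : ℝ} (hL : 0 < L) {w : ℝ → ℝ}
    (hw : Integrable w (mu L)) : IntervalIntegrable w volume 0 L := by
  rw [intervalIntegrable_iff_integrableOn_Ioo_of_le hL.le]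
  exact hw

lemma memLp_two_integrable {L : ℝ} {w : ℝ → ℝ} (hw : MemLp w 2 (mu L)) : Integrable w (mu L) :=
  hw.integrable (by norm_num)

/-- Subtracting the mean makes the primitive vanish at both ends, so an arbitrary `L²` function
becomes an admissible derivative. -/
lemma exists_integral_sub_eq_zero {L : ℝ} (hL : 0 < L) {w : ℝ → ℝ} (hw : Integrable w (mu L)) :
    ∃ m : ℝ, ∫ x, (w x - m) ∂(mu L) = 0 := by
  refine ⟨(∫ x, w x ∂(mu L)) / L, ?_⟩
  rw [integral_sub hw (integrable_const _), integral_const]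
  simp only [mu, measureReal_restrict_apply_univ, Real.volume_real_Ioo, smul_eq_mul]
  rw [sub_zero, max_eq_left hL.le, mul_div_cancel₀ _ hL.ne', sub_self]

/-! ### Distributions on the interval and primitives -/

/-- Two integrable functions that agree as distributions agree almost everywhere. -/
lemma EqDistrib.ae_eq {L : ℝ} {f h : ℝ → ℝ} (hf : Integrable f (mu L))
    (hh : Integrable h (mu L)) (hfh : EqDistrib L f h) : f =ᵐ[mu L] h := by
  have hmul : ∀ (ψ : 𝓓(interval L, ℝ)) (w : ℝ → ℝ), Integrable w (mu L) →
      Integrable (fun x => w x * ψ x) (mu L) := by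
    intro ψ w hw
    obtain ⟨C, hC⟩ := ψ.continuous.bounded_above_of_compact_support ψ.hasCompactSupport
    exact hw.mul_bdd ψ.continuous.aestronglyMeasurable (Eventually.of_forall hC)
  have key := IsOpen.ae_eq_zero_of_integral_contDiff_smul_eq_zero (μ := volume)
    (f := fun x => f x - h x) (isOpen_Ioo (a := (0 : ℝ)) (b := L))
    (IntegrableOn.locallyIntegrableOn (hf.sub hh)) ?_
  · have := ae_mu_iff.2 key
    filter_upwards [this] with x hx using sub_eq_zero.1 hx
  · intro ψ h1 h2 h3
    let Ψ : 𝓓(interval L, ℝ) := ⟨ψ, h1, h2, h3⟩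
    have e := hfh Ψ
    have e2 : ∫ x, (f x - h x) * Ψ x ∂(mu L) = 0 := by
      simp_rw [sub_mul]
      rw [integral_sub (hmul Ψ f hf) (hmul Ψ h hh), e, sub_self]
    rw [mu, setIntegral_eq_integral_of_forall_compl_eq_zero] at e2
    · rw [← e2]
      refine integral_congr_ae (Eventually.of_forall fun x => ?_)
      exact mul_comm (f x - h x) (ψ x) |>.symm
    · intro x hx
      have : ψ x = 0 := image_eq_zero_of_notMem_tsupport fun h => hx (h3 h)
      change _ * ψ x = 0
      simp [this]

lemma absolutelyContinuousOnInterval_testFunction {L : ℝ} (ψ : 𝓓(interval L, ℝ)) :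
    AbsolutelyContinuousOnInterval ψ 0 L :=
  (ψ.contDiff.of_le (by exact_mod_cast le_top)).contDiffOn.absolutelyContinuousOnInterval

lemma testFunction_eq_zero {L : ℝ} (ψ : 𝓓(interval L, ℝ)) {x : ℝ} (hx : x ∉ Ioo 0 L) :
    ψ x = 0 :=
  image_eq_zero_of_notMem_tsupport fun h => hx (ψ.tsupport_subset h)

/-- The primitive of an integrable function has that function as its weak derivative. -/
lemma integral_primitive_mul_deriv {L : ℝ} (hL : 0 < L) {w : ℝ → ℝ} (hw : Integrable w (mu L))
    (ψ : 𝓓(interval L, ℝ)) :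
    ∫ x, (∫ t in (0 : ℝ)..x, w t) * deriv ψ x ∂(mu L) = - ∫ x, w x * ψ x ∂(mu L) := by
  have hw' := intervalIntegrable_of_integrable hL hw
  have hac := hw'.absolutelyContinuousOnInterval_intervalIntegral (c := 0) (by simp)
  rw [integral_mu hL, integral_mu hL,
    hac.integral_mul_deriv_eq_deriv_mul (absolutelyContinuousOnInterval_testFunction ψ),
    testFunction_eq_zero ψ (x := L) (by simp), testFunction_eq_zero ψ (x := 0) (by simp)]
  simp only [mul_zero, sub_zero, zero_sub, neg_inj]
  apply intervalIntegral.integral_congr_ae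
  filter_upwards [hw'.ae_hasDerivAt_integral] with x hx hx'
  rw [(hx (uIoc_subset_uIcc hx') 0 (by simp)).deriv]

lemma continuousOn_primitive {L : ℝ} (hL : 0 < L) {w : ℝ → ℝ} (hw : Integrable w (mu L)) :
    ContinuousOn (fun x => ∫ t in (0 : ℝ)..x, w t) (Icc 0 L) := by
  have := ((intervalIntegrable_of_integrable hL hw).absolutelyContinuousOnInterval_intervalIntegral
    (c := 0) (by simp)).continuousOn
  rwa [uIcc_of_le hL.le] at this

lemma isH10_primitive {L : ℝ} (hL : 0 < L) {w : ℝ → ℝ} (hw : MemLp w 2 (mu L))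
    (h0 : ∫ x, w x ∂(mu L) = 0) : IsH10 L (fun x => ∫ t in (0 : ℝ)..x, w t) w where
  continuousOn := continuousOn_primitive hL (memLp_two_integrable hw)
  left := by simp
  right := by rw [← integral_mu hL, h0]
  memLp := hw
  weakDeriv := integral_primitive_mul_deriv hL (memLp_two_integrable hw)

/-- A test function of integral zero is the derivative of a test function. -/
lemma exists_testFunction_deriv_eq {L : ℝ} (hL : 0 < L) (η : 𝓓(interval L, ℝ))
    (h0 : ∫ x, η x ∂(mu L) = 0) : ∃ ψ : 𝓓(interval L, ℝ), deriv ψ = η := by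
  have hd : ∀ x, HasDerivAt (fun x => ∫ t in (0 : ℝ)..x, η t) (η x) x := fun x =>
    intervalIntegral.integral_hasDerivAt_right (η.continuous.intervalIntegrable _ _)
      η.continuous.stronglyMeasurable.stronglyMeasurableAtFilter η.continuous.continuousAt
  have hde : deriv (fun x => ∫ t in (0 : ℝ)..x, η t) = η := funext fun x => (hd x).deriv
  obtain ⟨a, b, ha, hb, hab⟩ : ∃ a b : ℝ, 0 < a ∧ b < L ∧ tsupport η ⊆ Icc a b := by
    rcases (tsupport η).eq_empty_or_nonempty with h | h
    · exact ⟨1, L - 1, one_pos, by linarith, by simp [h]⟩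
    · have hc : IsCompact (tsupport η) := η.hasCompactSupport
      exact ⟨sInf (tsupport η), sSup (tsupport η), (η.tsupport_subset (hc.sInf_mem h)).1,
        (η.tsupport_subset (hc.sSup_mem h)).2,
        fun x hx => ⟨csInf_le hc.bddBelow hx, le_csSup hc.bddAbove hx⟩⟩
  have hz : ∀ x, x ∉ Icc a b → η x = 0 := fun x hx =>
    image_eq_zero_of_notMem_tsupport fun h => hx (hab h)
  have hint : ∀ x y : ℝ, (∀ t ∈ uIcc x y, η t = 0) → ∫ t in x..y, η t = 0 := fun x y h => by
    rw [intervalIntegral.integral_congr (g := fun _ => 0) h]; simp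
  have hsupp : Function.support (fun x => ∫ t in (0 : ℝ)..x, η t) ⊆ Icc a b := by
    intro x hx
    by_contra hxab
    apply hx
    by_cases hxa : x < a
    · exact hint _ _ fun t ht => hz t fun h => by
        have := h.1
        rcases mem_uIcc.1 ht with h' | h' <;> linarith [h'.1, h'.2]
    · have hxb : b < x := by
        by_contra h
        exact hxab ⟨not_lt.1 hxa, not_lt.1 h⟩
      -- To the right of `b` the primitive keeps its value at `L`, the total integral of `η`, which
      -- is zero.
      have h1 : ∫ t in L..x, η t = 0 := hint _ _ fun t ht => hz t fun h => by
        have := h.2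
        rcases mem_uIcc.1 ht with h' | h' <;> linarith [h'.1, h'.2]
      change ∫ t in (0 : ℝ)..x, η t = 0
      rw [← intervalIntegral.integral_add_adjacent_intervals
        (η.continuous.intervalIntegrable 0 L) (η.continuous.intervalIntegrable L x), h1,
        ← integral_mu hL, h0, add_zero]
  have hts := closure_minimal hsupp isClosed_Icc
  refine ⟨⟨fun x => ∫ t in (0 : ℝ)..x, η t, ?_, ?_, ?_⟩, hde⟩
  · refine contDiff_infty_iff_deriv.2 ⟨fun x => (hd x).differentiableAt, ?_⟩
    rw [hde]
    exact η.contDiff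
  · exact HasCompactSupport.of_support_subset_isCompact isCompact_Icc hsupp
  · exact hts.trans fun x hx => ⟨ha.trans_le hx.1, hx.2.trans_lt hb⟩

/-- Otherwise, by scaling, every test function has integral zero, and the constants `1` and `0`
agree as distributions. -/
lemma exists_testFunction_integral_eq_one {L : ℝ} (hL : 0 < L) :
    ∃ η : 𝓓(interval L, ℝ), ∫ x, η x ∂(mu L) = 1 := by
  by_contra! hne
  have hz : ∀ η : 𝓓(interval L, ℝ), ∫ x, η x ∂(mu L) = 0 := by
    intro η
    by_contra h
    refine hne ((∫ x, η x ∂(mu L))⁻¹ • η) ?_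
    have : ∀ x, ((∫ x, η x ∂(mu L))⁻¹ • η) x = (∫ x, η x ∂(mu L))⁻¹ * η x := fun x => rfl
    simp_rw [this]
    rw [integral_const_mul, inv_mul_cancel₀ h]
  have := EqDistrib.ae_eq (L := L) (f := fun _ => 1) (h := fun _ => 0)
    (integrable_const _) (integrable_const _) (fun ψ => by simp [hz])
  have : NeBot (ae (mu L)) := ae_neBot.2 (mu_ne_zero hL)
  obtain ⟨x, hx⟩ := (‹_ =ᵐ[mu L] _› : _).exists
  exact one_ne_zero hx

/-- The lemma of du Bois-Reymond. -/
lemma eq_const_of_integral_mul_deriv_eq_zero {L : ℝ} (hL : 0 < L) {d : ℝ → ℝ}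
    (hd : ContinuousOn d (Icc 0 L))
    (h0 : ∀ ψ : 𝓓(interval L, ℝ), ∫ x, d x * deriv ψ x ∂(mu L) = 0) :
    ∃ c, ∀ x ∈ Icc 0 L, d x = c := by
  obtain ⟨η₀, hη₀⟩ := exists_testFunction_integral_eq_one hL
  have hdi : Integrable d (mu L) := (hd.integrableOn_Icc).mono_set Ioo_subset_Icc_self
  have hmul : ∀ (ψ : 𝓓(interval L, ℝ)), Integrable (fun x => d x * ψ x) (mu L) := by
    intro ψ
    obtain ⟨C, hC⟩ := ψ.continuous.bounded_above_of_compact_support ψ.hasCompactSupport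
    exact hdi.mul_bdd ψ.continuous.aestronglyMeasurable (Eventually.of_forall hC)
  have hint : ∀ (ψ : 𝓓(interval L, ℝ)), Integrable ψ (mu L) := fun ψ =>
    (ψ.continuous.integrable_of_hasCompactSupport ψ.hasCompactSupport).mono_measure
      Measure.restrict_le_self
  refine ⟨∫ x, d x * η₀ x ∂(mu L), ?_⟩
  have hae := EqDistrib.ae_eq hdi (integrable_const (∫ x, d x * η₀ x ∂(mu L)))
    (fun η => ?_)
  · have := Measure.eqOn_Icc_of_ae_eq volume hL.ne (f := d)
      (g := fun _ => ∫ x, d x * η₀ x ∂(mu L)) ?_ hd continuousOn_const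
    · exact this
    · rw [← restrict_Ioo_eq_restrict_Icc]; exact hae
  -- Removing the multiple of `η₀` with the same integral leaves a mean-zero test function, hence a
  -- derivative, to which `h0` applies.
  · have e : ∀ x, (η - (∫ x, η x ∂(mu L)) • η₀) x = η x - (∫ x, η x ∂(mu L)) * η₀ x :=
      fun x => rfl
    obtain ⟨ψ, hψ⟩ := exists_testFunction_deriv_eq hL (η - (∫ x, η x ∂(mu L)) • η₀) (by
      simp_rw [e]
      rw [integral_sub (hint _) ((hint _).const_mul _), integral_const_mul, hη₀]
      ring)
    have := h0 ψ
    have e' : ∀ x, d x * deriv ψ x = d x * η x - (∫ x, η x ∂(mu L)) * (d x * η₀ x) := by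
      intro x
      rw [hψ, e]
      ring
    simp_rw [e'] at this
    rw [integral_sub (hmul _) ((hmul _).const_mul _), integral_const_mul] at this
    rw [integral_const_mul]
    linarith

/-- The continuous representative is the primitive of the weak derivative. -/
lemma IsH10.eq_primitive {L : ℝ} (hL : 0 < L) {u du : ℝ → ℝ} (h : IsH10 L u du) {x : ℝ}
    (hx : x ∈ Icc 0 L) : u x = ∫ t in (0 : ℝ)..x, du t := by
  have hi := memLp_two_integrable h.memLp
  have hbd : ∀ v : ℝ → ℝ, ContinuousOn v (Icc 0 L) → ∀ ψ : 𝓓(interval L, ℝ),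
      Integrable (fun x => v x * deriv ψ x) (mu L) := fun v hv ψ =>
    (hv.mul (ψ.contDiff.continuous_deriv
      (by exact_mod_cast le_top)).continuousOn).integrableOn_Icc.mono_set Ioo_subset_Icc_self
  obtain ⟨c, hc⟩ := eq_const_of_integral_mul_deriv_eq_zero hL
    (d := fun x => u x - ∫ t in (0 : ℝ)..x, du t)
    (h.continuousOn.sub (continuousOn_primitive hL hi)) (fun ψ => by
      simp_rw [sub_mul]
      rw [integral_sub (hbd _ h.continuousOn _) (hbd _ (continuousOn_primitive hL hi) _),
        h.weakDeriv, integral_primitive_mul_deriv hL hi, sub_self])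
  have h1 := hc x hx
  have h2 := hc 0 ⟨le_rfl, hL.le⟩
  simp only [h.left, intervalIntegral.integral_same, sub_zero] at h2
  linarith

lemma IsH10.integral_eq_zero {L : ℝ} (hL : 0 < L) {u du : ℝ → ℝ} (h : IsH10 L u du) :
    ∫ x, du x ∂(mu L) = 0 := by
  rw [integral_mu hL, ← h.eq_primitive hL (x := L) ⟨hL.le, le_rfl⟩, h.right]

lemma IsH10.sub_eq {L : ℝ} (hL : 0 < L) {u du : ℝ → ℝ} (h : IsH10 L u du) {x y : ℝ}
    (hx : x ∈ Icc 0 L) (hy : y ∈ Icc 0 L) (hxy : x ≤ y) :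
    u y - u x = ∫ t in Ioo x y, du t ∂(mu L) := by
  have hi := intervalIntegrable_of_integrable hL (memLp_two_integrable h.memLp)
  rw [h.eq_primitive hL hx, h.eq_primitive hL hy, intervalIntegral.integral_interval_sub_left,
    intervalIntegral.integral_of_le hxy, mu, Measure.restrict_restrict measurableSet_Ioo,
    integral_Ioc_eq_integral_Ioo, inter_eq_left.2 (Ioo_subset_Ioo hx.1 hy.2)]
  · exact hi.mono_set (by rw [uIcc_of_le hy.1, uIcc_of_le hL.le]; exact Icc_subset_Icc le_rfl hy.2)
  · exact hi.mono_set (by rw [uIcc_of_le hx.1, uIcc_of_le hL.le]; exact Icc_subset_Icc le_rfl hx.2)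


/-! ### `L²` estimates and weak convergence in `H^1_0` -/

lemma inner_toLp_eq_integral {L : ℝ} {f w : ℝ → ℝ} (hf : MemLp f 2 (mu L))
    (hw : MemLp w 2 (mu L)) : inner ℝ (hf.toLp f) (hw.toLp w) = ∫ x, f x * w x ∂(mu L) := by
  rw [L2.inner_def]
  refine integral_congr_ae ?_
  filter_upwards [hf.coeFn_toLp, hw.coeFn_toLp] with x h1 h2
  rw [h1, h2]
  simp [mul_comm]

/-- The Cauchy-Schwarz inequality. -/
lemma abs_integral_mul_le {L : ℝ} {f w : ℝ → ℝ} (hf : MemLp f 2 (mu L)) (hw : MemLp w 2 (mu L)) :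
    |∫ x, f x * w x ∂(mu L)| ≤ (eLpNorm f 2 (mu L)).toReal * (eLpNorm w 2 (mu L)).toReal := by
  rw [← inner_toLp_eq_integral hf hw, ← Lp.norm_toLp f hf, ← Lp.norm_toLp w hw]
  exact abs_real_inner_le_norm _ _

lemma memLp_indicator_one {L : ℝ} (x y : ℝ) :
    MemLp ((Ioo x y).indicator fun _ => (1 : ℝ)) 2 (mu L) :=
  (memLp_const 1).indicator measurableSet_Ioo

lemma integral_mul_indicator_one {L : ℝ} (f : ℝ → ℝ) (x y : ℝ) :
    ∫ t, f t * (Ioo x y).indicator (fun _ => (1 : ℝ)) t ∂(mu L) = ∫ t in Ioo x y, f t ∂(mu L) := by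
  rw [← integral_indicator measurableSet_Ioo]
  congr 1
  ext t
  by_cases h : t ∈ Ioo x y <;> simp [h]

/-- Cauchy-Schwarz against the indicator of the interval. No order on `x, y` is needed: if `y ≤ x`,
the interval is empty and the square root is zero. -/
lemma abs_setIntegral_le {L K : ℝ} {f : ℝ → ℝ} (hf : MemLp f 2 (mu L)) (hK : 0 ≤ K)
    (hfK : eLpNorm f 2 (mu L) ≤ ENNReal.ofReal K) {x y : ℝ} :
    |∫ t in Ioo x y, f t ∂(mu L)| ≤ K * √(y - x) := by
  rw [← integral_mul_indicator_one]
  refine (abs_integral_mul_le hf (memLp_indicator_one x y)).trans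
    (mul_le_mul (ENNReal.toReal_le_of_le_ofReal hK hfK) ?_ ENNReal.toReal_nonneg hK)
  refine ENNReal.toReal_le_of_le_ofReal (Real.sqrt_nonneg _) ?_
  refine (eLpNorm_mono_measure _ Measure.restrict_le_self).trans ?_
  rw [eLpNorm_indicator_const measurableSet_Ioo (by norm_num) (by norm_num), Real.volume_Ioo]
  rw [enorm_one, one_mul, Real.sqrt_eq_rpow]
  rcases le_total 0 (y - x) with h | h
  · rw [ENNReal.ofReal_rpow_of_nonneg h (by norm_num)]
    norm_num
  · rw [ENNReal.ofReal_of_nonpos h]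
    simp

/-- Derivatives of elements of `H^1_0` have mean zero, so weak convergence in `H^1_0` is weak
convergence of the derivatives in `L^2`. -/
lemma WeakTendstoH10.tendsto_integral_mul {L : ℝ} (hL : 0 < L) {u du : ℕ → ℝ → ℝ} {u₀ du₀ : ℝ → ℝ}
    (h : WeakTendstoH10 L u du u₀ du₀) {w : ℝ → ℝ} (hw : MemLp w 2 (mu L)) :
    Tendsto (fun k => ∫ x, du k x * w x ∂(mu L)) atTop (𝓝 (∫ x, du₀ x * w x ∂(mu L))) := by
  obtain ⟨m, hm⟩ := exists_integral_sub_eq_zero hL (memLp_two_integrable hw)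
  have hw' : MemLp (fun x => w x - m) 2 (mu L) := hw.sub (memLp_const m)
  have key : ∀ v dv : ℝ → ℝ, IsH10 L v dv →
      ∫ x, dv x * (w x - m) ∂(mu L) = ∫ x, dv x * w x ∂(mu L) := by
    intro v dv hv
    have h1 : Integrable (fun x => dv x * w x) (mu L) := hv.memLp.integrable_mul hw
    simp_rw [mul_sub]
    rw [integral_sub h1 ((memLp_two_integrable hv.memLp).mul_const m), integral_mul_const,
      hv.integral_eq_zero hL, zero_mul, sub_zero]
  have := h.2.2 _ _ (isH10_primitive hL hw' hm)
  rw [key _ _ h.2.1] at this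
  simpa only [key _ _ (h.1 _)] using this

/-- Uniform boundedness principle: the pairing with each fixed `L²` function converges, so it is
bounded in `k`. -/
lemma WeakTendstoH10.exists_bound {L : ℝ} (hL : 0 < L) {u du : ℕ → ℝ → ℝ} {u₀ du₀ : ℝ → ℝ}
    (h : WeakTendstoH10 L u du u₀ du₀) :
    ∃ K : ℝ, 0 ≤ K ∧ ∀ k, eLpNorm (du k) 2 (mu L) ≤ ENNReal.ofReal K := by
  have hu := h.1
  obtain ⟨C, hC⟩ := banach_steinhaus
    (g := fun k => innerSL ℝ ((hu k).memLp.toLp (du k))) (fun w => by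
      obtain ⟨C, hC⟩ := ((h.tendsto_integral_mul hL (Lp.memLp w)).abs).bddAbove_range
      refine ⟨C, fun k => ?_⟩
      have : |∫ x, du k x * w x ∂(mu L)| ≤ C := hC (mem_range_self k)
      rwa [← inner_toLp_eq_integral (hu k).memLp (Lp.memLp w), Lp.toLp_coeFn] at this)
  have hC0 : 0 ≤ C := (norm_nonneg _).trans (hC 0)
  refine ⟨C, hC0, fun k => ?_⟩
  have := hC k
  rw [innerSL_apply_norm, Lp.norm_toLp] at this
  exact (ENNReal.le_ofReal_iff_toReal_le (hu k).memLp.2.ne hC0).2 this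

lemma IsH10.abs_sub_le {L K : ℝ} (hL : 0 < L) {u du : ℝ → ℝ} (h : IsH10 L u du) (hK : 0 ≤ K)
    (hdK : eLpNorm du 2 (mu L) ≤ ENNReal.ofReal K) {x y : ℝ} (hx : x ∈ Icc 0 L)
    (hy : y ∈ Icc 0 L) : |u y - u x| ≤ K * √|y - x| := by
  wlog hxy : x ≤ y generalizing x y
  · rw [abs_sub_comm (u y), abs_sub_comm y]
    exact this hy hx (not_le.1 hxy).le
  · rw [h.sub_eq hL hx hy hxy, abs_of_nonneg (sub_nonneg.2 hxy)]
    exact abs_setIntegral_le h.memLp hK hdK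

/-- Since `u(0) = 0`, evaluation at `x` is the pairing of `u'` with the indicator of `(0, x)`. -/
lemma WeakTendstoH10.tendsto_apply {L : ℝ} (hL : 0 < L) {u du : ℕ → ℝ → ℝ} {u₀ du₀ : ℝ → ℝ}
    (h : WeakTendstoH10 L u du u₀ du₀) {x : ℝ} (hx : x ∈ Icc 0 L) :
    Tendsto (fun k => u k x) atTop (𝓝 (u₀ x)) := by
  have key : ∀ v dv : ℝ → ℝ, IsH10 L v dv → ∫ t in Ioo 0 x, dv t ∂(mu L) = v x := by
    intro v dv hv
    rw [← hv.sub_eq hL ⟨le_rfl, hL.le⟩ hx hx.1, hv.left, sub_zero]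
  have := h.tendsto_integral_mul hL (memLp_indicator_one 0 x)
  simp_rw [integral_mul_indicator_one] at this
  rw [key _ _ h.2.1] at this
  simpa only [key _ _ (h.1 _)] using this

/-- Weak convergence in `H^1_0` implies locally uniform convergence. -/
lemma WeakTendstoH10.tendsto_prod {L : ℝ} (hL : 0 < L) {u du : ℕ → ℝ → ℝ} {u₀ du₀ : ℝ → ℝ}
    (h : WeakTendstoH10 L u du u₀ du₀) {x : ℝ} (hx : x ∈ Icc 0 L) :
    Tendsto (fun p : ℕ × ℝ => u p.1 p.2) (atTop ×ˢ 𝓝[Icc 0 L] x) (𝓝 (u₀ x)) := by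
  obtain ⟨K, hK, hb⟩ := h.exists_bound hL
  have h1 : Tendsto (fun p : ℕ × ℝ => u p.1 x) (atTop ×ˢ 𝓝[Icc 0 L] x) (𝓝 (u₀ x)) :=
    (h.tendsto_apply hL hx).comp tendsto_fst
  have h2 : Tendsto (fun p : ℕ × ℝ => u p.1 p.2 - u p.1 x) (atTop ×ˢ 𝓝[Icc 0 L] x) (𝓝 0) := by
    have h3 : Tendsto (fun y : ℝ => K * √|y - x|) (𝓝[Icc 0 L] x) (𝓝 0) := by
      have : Continuous fun y : ℝ => K * √|y - x| := by fun_prop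
      simpa using (this.tendsto x).mono_left nhdsWithin_le_nhds
    refine squeeze_zero_norm' ?_ (h3.comp tendsto_snd)
    have : ∀ᶠ p : ℕ × ℝ in atTop ×ˢ 𝓝[Icc 0 L] x, p.2 ∈ Icc 0 L :=
      tendsto_snd.eventually self_mem_nhdsWithin
    filter_upwards [this] with p hp
    exact (h.1 p.1).abs_sub_le hL hK (hb p.1) hx hp
  simpa using h1.add h2

/-! ### Weak `L²` limits from pointwise limits -/

/-- A bounded sequence in `L^2` that converges almost everywhere in the extended reals converges
weakly in `L^2`, and the limit is finite almost everywhere. -/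
lemma weakTendstoL2Ext_of_ae {L K : ℝ} {f : ℕ → ℝ → ℝ} {F : ℝ → EReal}
    (hf : ∀ k, MemLp (f k) 2 (mu L)) (hK : ∀ k, eLpNorm (f k) 2 (mu L) ≤ ENNReal.ofReal K)
    (hF : ∀ᵐ x ∂(mu L), Tendsto (fun k => (f k x : EReal)) atTop (𝓝 (F x))) :
    WeakTendstoL2Ext L f F := by
  have hfin : ∀ᵐ x ∂(mu L), F x ≠ ⊤ ∧ F x ≠ ⊥ := by
    -- Fatou: the `L²` bound makes `liminf |f k|` finite almost everywhere, which rules out infinite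
    -- limits.
    have hmk := ae_bdd_liminf_atTop_of_eLpNorm_bdd (R := K.toNNReal) (p := 2) (μ := mu L)
      (by norm_num) (f := fun k => (hf k).1.mk (f k))
      (fun k => (hf k).1.stronglyMeasurable_mk.measurable)
      (fun k => by rw [← eLpNorm_congr_ae (hf k).1.ae_eq_mk]; exact hK k)
    filter_upwards [hmk, hF, ae_all_iff.2 fun k => (hf k).1.ae_eq_mk] with x h1 h2 h3
    simp_rw [← h3] at h1
    by_contra hcon
    have htop : Tendsto (fun k => |f k x|) atTop atTop := by
      rcases not_and_or.1 hcon with h | h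
      · rw [not_not.1 h, EReal.tendsto_coe_nhds_top_iff] at h2
        exact tendsto_abs_atTop_atTop.comp h2
      · rw [not_not.1 h, EReal.tendsto_coe_nhds_bot_iff] at h2
        exact tendsto_abs_atBot_atTop.comp h2
    have : Tendsto (fun k => ‖f k x‖ₑ) atTop (𝓝 ⊤) := by
      simp_rw [Real.enorm_eq_ofReal_abs]
      exact ENNReal.tendsto_ofReal_atTop.comp htop
    rw [this.liminf_eq] at h1
    exact lt_irrefl _ h1
  have hlim : ∀ᵐ x ∂(mu L), Tendsto (fun k => f k x) atTop (𝓝 (F x).toReal) := by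
    filter_upwards [hF, hfin] with x h1 h2
    exact (EReal.tendsto_toReal h2.1 h2.2).comp h1
  have hmeas : AEStronglyMeasurable (fun x => (F x).toReal) (mu L) :=
    aestronglyMeasurable_of_tendsto_ae atTop (fun k => (hf k).1) hlim
  have hmem : MemLp (fun x => (F x).toReal) 2 (mu L) := by
    refine ⟨hmeas, (Lp.eLpNorm_lim_le_liminf_eLpNorm (fun k => (hf k).1) _ hlim).trans_lt ?_⟩
    refine lt_of_le_of_lt ?_ (ENNReal.ofReal_lt_top (r := K))
    refine (liminf_le_liminf (Eventually.of_forall hK)).trans ?_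
    simp
  refine ⟨hfin, hf, hmem, fun w hw => ?_⟩
  refine tendsto_integral_of_L1' _ (hmem.integrable_mul hw).1
    (Eventually.of_forall fun k => (hf k).integrable_mul hw) ?_
  -- Vitali: by Hölder, `f k * w` has `L¹` norm on `s` at most `K` times the `L²` norm of `w` on
  -- `s`, small uniformly in `k`.
  refine tendsto_Lp_finite_of_tendsto_ae le_rfl (by norm_num)
    (fun k => ((hf k).integrable_mul hw).1) (memLp_one_iff_integrable.2 (hmem.integrable_mul hw))
    ?_ ?_
  · intro ε hε
    obtain ⟨δ, hδ, hs⟩ := hw.eLpNorm_indicator_le (by norm_num) (by norm_num)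
      (ε := ε / (|K| + 1)) (by positivity)
    refine ⟨δ, hδ, fun k s hsm hsδ => ?_⟩
    have e : s.indicator (fun x => f k x * w x) = f k • s.indicator w := by
      ext x
      by_cases hx : x ∈ s <;> simp [hx]
    rw [e]
    refine (eLpNorm_smul_le_mul_eLpNorm (p := 2) (q := 2) (hw.1.indicator hsm) (hf k).1).trans ?_
    refine (mul_le_mul' (hK k) (hs s hsm hsδ)).trans ?_
    rw [← ENNReal.ofReal_mul' (by positivity)]
    refine ENNReal.ofReal_le_ofReal ?_
    rw [mul_div_assoc', div_le_iff₀ (by positivity)]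
    nlinarith [le_abs_self K]
  · filter_upwards [hlim] with x hx using hx.mul_const _


/-! ### Joint convergence and compactness -/

/-- The sequential convergence of a reasonable approximation is joint convergence. -/
lemma IsReasonableApprox.tendsto_prod {φn : ℕ → ℝ → EReal} {φ : ℝ → EReal}
    (h : IsReasonableApprox φn φ) (s₀ : ℝ) :
    Tendsto (fun p : ℕ × ℝ => φn p.1 p.2) (atTop ×ˢ 𝓝 s₀) (𝓝 (φ s₀)) := by
  by_contra hcon
  obtain ⟨U, hU, hfr⟩ := not_tendsto_iff_exists_frequently_notMem.1 hcon
  obtain ⟨ns, hns, hbad⟩ := exists_seq_forall_of_frequently hfr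
  obtain ⟨θ, hθ, hN⟩ := strictMono_subseq_of_tendsto_atTop (tendsto_fst.comp hns)
  have hS : Tendsto (fun j => (ns (θ j)).2) atTop (𝓝 s₀) :=
    (tendsto_snd.comp hns).comp hθ.tendsto_atTop
  set N : ℕ → ℕ := (Prod.fst ∘ ns) ∘ θ
  -- The hypothesis concerns full sequences, so the bad points, indexed by the strictly increasing
  -- `N`, are completed by the constant `s₀`.
  set s : ℕ → ℝ := Function.extend N (fun j => (ns (θ j)).2) (fun _ => s₀) with hs
  have hsN : ∀ j, s (N j) = (ns (θ j)).2 := fun j => hN.injective.extend_apply _ _ j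
  have hlim : Tendsto s atTop (𝓝 s₀) := by
    intro V hV
    obtain ⟨J, hJ⟩ := eventually_atTop.1 (hS.eventually hV)
    refine mem_map.2 (mem_atTop_sets.2 ⟨N J, fun n hn => ?_⟩)
    by_cases hex : ∃ j, N j = n
    · obtain ⟨j, rfl⟩ := hex
      rw [mem_preimage, hsN]
      exact hJ j (hN.le_iff_le.1 hn)
    · rw [mem_preimage, hs, Function.extend_apply' _ _ _ hex]
      exact mem_of_mem_nhds hV
  obtain ⟨j, hj⟩ := (((h.tendsto s s₀ hlim).comp hN.tendsto_atTop).eventually hU).exists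
  rw [Function.comp_apply, hsN] at hj
  exact hbad (θ j) hj

/-- A property that holds eventually near each point of a compact set holds eventually on it. -/
lemma eventually_forall_mem_of_prod {K : Set ℝ} (hK : IsCompact K) {P : ℕ → ℝ → Prop}
    (h : ∀ x ∈ K, ∀ᶠ p : ℕ × ℝ in atTop ×ˢ 𝓝[K] x, P p.1 p.2) :
    ∀ᶠ k in atTop, ∀ x ∈ K, P k x := by
  refine hK.induction_on (p := fun s => ∀ᶠ k in atTop, ∀ x ∈ s, P k x) (by simp)
    (fun s t hst ht => ht.mono fun k hk x hx => hk x (hst hx))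
    (fun s t hs ht => ?_) (fun x hx => ?_)
  · filter_upwards [hs, ht] with k h1 h2 x hx
    exact hx.elim (h1 x) (h2 x)
  · obtain ⟨pa, ha, pb, hb, hab⟩ := eventually_prod_iff.1 (h x hx)
    exact ⟨{y | pb y}, hb, ha.mono fun k hk y hy => hab hk hy⟩

/-- A limit above `-∞` gives a lower bound near each point, even where it is `+∞`; finitely many
such neighbourhoods cover `[0, L]`. -/
lemma exists_lower_bound {L : ℝ} {f : ℕ → ℝ → ℝ} {F : ℝ → EReal} (hF : ∀ x, F x ≠ ⊥)
    (h : ∀ x ∈ Icc 0 L,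
      Tendsto (fun p : ℕ × ℝ => (f p.1 p.2 : EReal)) (atTop ×ˢ 𝓝[Icc 0 L] x) (𝓝 (F x))) :
    ∃ M : ℝ, ∀ᶠ k in atTop, ∀ x ∈ Icc 0 L, M ≤ f k x := by
  refine isCompact_Icc.induction_on
    (p := fun s => ∃ M : ℝ, ∀ᶠ k in atTop, ∀ x ∈ s, M ≤ f k x) ⟨0, by simp⟩
    (fun s t hst ⟨M, ht⟩ => ⟨M, ht.mono fun k hk x hx => hk x (hst hx)⟩)
    (fun s t ⟨M, hs⟩ ⟨M', ht⟩ => ⟨min M M', ?_⟩) (fun x hx => ?_)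
  · filter_upwards [hs, ht] with k h1 h2 x hx
    exact hx.elim (fun hx => (min_le_left _ _).trans (h1 x hx))
      (fun hx => (min_le_right _ _).trans (h2 x hx))
  · obtain ⟨M, -, hM⟩ := EReal.lt_iff_exists_real_btwn.1 (bot_lt_iff_ne_bot.2 (hF x))
    obtain ⟨pa, ha, pb, hb, hab⟩ := eventually_prod_iff.1 ((h x hx).eventually (lt_mem_nhds hM))
    exact ⟨{y | pb y}, hb, M, ha.mono fun k hk y hy => (EReal.coe_lt_coe_iff.1 (hab hk hy)).le⟩

lemma mul_le_of_forall_le {L K T : ℝ} {h : ℝ → ℝ} (hh : MemLp h 2 (mu L)) (hK : 0 ≤ K)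
    (hhK : eLpNorm h 2 (mu L) ≤ ENNReal.ofReal K) {x y : ℝ} (hx : 0 ≤ x) (hy : y ≤ L)
    (hxy : x < y) (hT : ∀ t ∈ Ioo x y, T ≤ h t) : T * (y - x) ≤ K * √(y - x) := by
  refine le_trans ?_ ((le_abs_self _).trans (abs_setIntegral_le hh hK hhK (x := x) (y := y)))
  have := setIntegral_mono_on (μ := mu L) (s := Ioo x y) (f := fun _ => T) (g := h)
    (integrable_const T) (memLp_two_integrable hh).integrableOn measurableSet_Ioo hT
  refine le_trans (le_of_eq ?_) this
  rw [mu, Measure.restrict_restrict measurableSet_Ioo, inter_eq_left.2 (Ioo_subset_Ioo hx hy),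
    setIntegral_const, Real.volume_real_Ioo_of_le hxy.le, smul_eq_mul, mul_comm]

/-! ### The flux identity and its constant -/

lemma memLp_of_continuousOn {L : ℝ} {f : ℝ → ℝ} (hf : ContinuousOn f (Icc 0 L)) :
    MemLp f 2 (mu L) := by
  obtain ⟨C, hC⟩ := isCompact_Icc.exists_bound_of_continuousOn hf
  refine MemLp.of_bound (hf.integrableOn_Icc.mono_set Ioo_subset_Icc_self).1 C ?_
  exact ae_mu_iff.2 (Eventually.of_forall fun x hx => hC x (Ioo_subset_Icc_self hx))

lemma IsCoefficient.norm_mul_le {L α β : ℝ} {a : ℝ → ℝ} (ha : IsCoefficient L α β a)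
    (w : ℝ → ℝ) : ∀ᵐ x ∂(mu L), ‖a x * w x‖ ≤ β * ‖w x‖ := by
  filter_upwards [ha.bounds] with x hx
  rw [norm_mul, Real.norm_of_nonneg (ha.pos.le.trans hx.1)]
  exact mul_le_mul_of_nonneg_right hx.2 (norm_nonneg _)

lemma IsCoefficient.memLp_mul {L α β : ℝ} {a : ℝ → ℝ} (ha : IsCoefficient L α β a) {w : ℝ → ℝ}
    (hw : MemLp w 2 (mu L)) : MemLp (fun x => a x * w x) 2 (mu L) :=
  hw.of_le_mul (ha.meas.mul hw.1) (ha.norm_mul_le w)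

/-- With `F = a u' - φ(u) - g` and mean `c`, testing with the primitive of `F - c` gives `∫ F (F -
c) = 0`; since `∫ (F - c) = 0`, also `∫ (F - c)² = 0`. -/
lemma IsWeakSolution.exists_const {L α β : ℝ} (hL : 0 < L) {a g φ u du : ℝ → ℝ}
    (ha : IsCoefficient L α β a) (hg : MemLp g 2 (mu L)) (hφ : Continuous φ)
    (h : IsWeakSolution L a g φ u du) :
    ∃ c : ℝ, (fun x => a x * du x) =ᵐ[mu L] fun x => φ (u x) + g x + c := by
  have hA := ha.memLp_mul h.1.memLp
  have hP : MemLp (fun x => φ (u x)) 2 (mu L) :=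
    memLp_of_continuousOn (hφ.comp_continuousOn h.1.continuousOn)
  have hF : MemLp (fun x => a x * du x - φ (u x) - g x) 2 (mu L) := (hA.sub hP).sub hg
  set F := fun x => a x * du x - φ (u x) - g x with hFdef
  obtain ⟨c, hm⟩ := exists_integral_sub_eq_zero hL (memLp_two_integrable hF)
  have hw : MemLp (fun x => F x - c) 2 (mu L) := hF.sub (memLp_const c)
  have hvar := h.2 _ _ (isH10_primitive hL hw hm)
  have h0 : ∫ x, F x * (F x - c) ∂(mu L) = 0 := by
    have i1 : Integrable (fun x => a x * du x * (F x - c)) (mu L) := hA.integrable_mul hw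
    have i2 : Integrable (fun x => φ (u x) * (F x - c)) (mu L) := hP.integrable_mul hw
    have i3 : Integrable (fun x => g x * (F x - c)) (mu L) := hg.integrable_mul hw
    have i12 : Integrable (fun x => a x * du x * (F x - c) - φ (u x) * (F x - c)) (mu L) :=
      i1.sub i2
    have e : ∀ x, F x * (F x - c) =
        a x * du x * (F x - c) - φ (u x) * (F x - c) - g x * (F x - c) := fun x => by
      simp only [hFdef]
      ring
    simp_rw [e]
    rw [integral_sub i12 i3, integral_sub i1 i2, hvar]
    ring
  have hsq : ∫ x, (F x - c) * (F x - c) ∂(mu L) = 0 := by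
    have e : ∀ x, (F x - c) * (F x - c) = F x * (F x - c) - c * (F x - c) := fun x => by ring
    have i : Integrable (fun x => F x * (F x - c)) (mu L) := hF.integrable_mul hw
    simp_rw [e]
    rw [integral_sub i ((memLp_two_integrable hw).const_mul c),
      integral_const_mul, h0, hm]
    simp
  rw [integral_eq_zero_iff_of_nonneg (fun x => mul_self_nonneg _) (hw.integrable_mul hw)] at hsq
  refine ⟨c, ?_⟩
  filter_upwards [hsq] with x hx
  have := mul_self_eq_zero.1 hx
  simp only [hFdef] at this
  linarith

lemma IsWeakSolution.ae_eq {L α β c : ℝ} {a g φ u du : ℝ → ℝ}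
    (ha : IsCoefficient L α β a) (hg : MemLp g 2 (mu L)) (hφ : Continuous φ)
    (h : IsWeakSolution L a g φ u du)
    (hc : EqDistrib L (fun x => a x * du x) (fun x => φ (u x) + g x + c)) :
    (fun x => a x * du x) =ᵐ[mu L] fun x => φ (u x) + g x + c :=
  EqDistrib.ae_eq (memLp_two_integrable (ha.memLp_mul h.1.memLp)) (memLp_two_integrable
    (((memLp_of_continuousOn (hφ.comp_continuousOn h.1.continuousOn)).add hg).add
      (memLp_const c))) hc

lemma IsWeakSolution.existsUnique_const {L α β : ℝ} (hL : 0 < L) {a g φ u du : ℝ → ℝ}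
    (ha : IsCoefficient L α β a) (hg : MemLp g 2 (mu L)) (hφ : Continuous φ)
    (h : IsWeakSolution L a g φ u du) :
    ∃! c : ℝ, EqDistrib L (fun x => a x * du x) (fun x => φ (u x) + g x + c) := by
  obtain ⟨c, hc⟩ := h.exists_const hL ha hg hφ
  refine ⟨c, fun ψ => integral_congr_ae ?_, fun c' hc' => ?_⟩
  · filter_upwards [hc] with x hx
    rw [hx]
  · have : NeBot (ae (mu L)) := ae_neBot.2 (mu_ne_zero hL)
    obtain ⟨x, h1, h2⟩ := (hc.and (h.ae_eq ha hg hφ hc')).exists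
    linarith

/-- The flux gives an `L^2` bound on `φ(u) + c`. -/
lemma IsWeakSolution.eLpNorm_add_const_le {L α β c K C : ℝ} {a g φ u du : ℝ → ℝ}
    (ha : IsCoefficient L α β a) (hg : MemLp g 2 (mu L)) (hφ : Continuous φ)
    (h : IsWeakSolution L a g φ u du)
    (hc : EqDistrib L (fun x => a x * du x) (fun x => φ (u x) + g x + c))
    (hK : 0 ≤ K) (hdu : eLpNorm du 2 (mu L) ≤ ENNReal.ofReal K)
    (hC : 0 ≤ C) (hgC : eLpNorm g 2 (mu L) ≤ ENNReal.ofReal C) :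
    eLpNorm (fun x => φ (u x) + c) 2 (mu L) ≤ ENNReal.ofReal (β * K + C) := by
  have hβ : 0 ≤ β := (ha.pos.trans ha.lt).le
  have e : (fun x => φ (u x) + c) =ᵐ[mu L] (fun x => a x * du x) - g := by
    filter_upwards [h.ae_eq ha hg hφ hc] with x hx
    rw [Pi.sub_apply, hx]
    ring
  rw [eLpNorm_congr_ae e, ENNReal.ofReal_add (by positivity) hC, ENNReal.ofReal_mul hβ]
  refine (eLpNorm_sub_le (ha.memLp_mul h.1.memLp).1 hg.1 (by norm_num)).trans
    (add_le_add ?_ hgC)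
  exact (eLpNorm_le_mul_eLpNorm_of_ae_le_mul (ha.norm_mul_le du) 2).trans
    (mul_le_mul' le_rfl hdu)


/-! ### One-sided bounds on the constant -/

lemma le_of_forall_add_le {L K M c : ℝ} {f : ℝ → ℝ} (hf : MemLp f 2 (mu L)) (hK : 0 ≤ K)
    (hfK : eLpNorm (fun x => f x + c) 2 (mu L) ≤ ENNReal.ofReal K) {x y : ℝ} (hx : 0 ≤ x)
    (hy : y ≤ L) (hxy : x < y) (hM : ∀ t ∈ Ioo x y, M ≤ f t) :
    c ≤ K * √(y - x) / (y - x) - M := by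
  have := mul_le_of_forall_le (hf.add (memLp_const c)) hK hfK hx hy hxy (T := M + c)
    (fun t ht => by simpa using hM t ht)
  rw [← le_div_iff₀ (sub_pos.2 hxy)] at this
  linarith

lemma le_of_forall_le_add {L K M c : ℝ} {f : ℝ → ℝ} (hf : MemLp f 2 (mu L)) (hK : 0 ≤ K)
    (hfK : eLpNorm (fun x => f x + c) 2 (mu L) ≤ ENNReal.ofReal K) {x y : ℝ} (hx : 0 ≤ x)
    (hy : y ≤ L) (hxy : x < y) (hM : ∀ t ∈ Ioo x y, f t ≤ M) :
    -(K * √(y - x) / (y - x)) - M ≤ c := by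
  have e : (fun x => -f x + -c) = -fun x => f x + c := by
    ext x
    simp only [Pi.neg_apply]
    ring
  have := le_of_forall_add_le (f := fun x => -f x) (c := -c) (M := -M) hf.neg hK
    (by rwa [e, eLpNorm_neg]) hx hy hxy (fun t ht => neg_le_neg (hM t ht))
  linarith

end SingularODE

/-! ### The dichotomy for the limit -/

theorem mainTheorem10
    (L : ℝ) (hL : 0 < L)
    -- the limit data
    (a g : ℝ → ℝ) (φ : ℝ → EReal)
    (ha : ∃ α β : ℝ, SingularODE.IsCoefficient L α β a)
    (hg : MemLp g 2 (SingularODE.mu L))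
    (hφ : SingularODE.IsNonlinearity φ) (hφ0 : φ 0 = ⊤)
    -- the approximating data
    (an gn φn : ℕ → ℝ → ℝ)
    (han : ∃ α β : ℝ, ∀ n, SingularODE.IsCoefficient L α β (an n))
    (hana : ∀ᵐ x ∂(SingularODE.mu L), Tendsto (fun n => an n x) atTop (𝓝 (a x)))
    (hgn : ∃ C : ℝ, 0 < C ∧ ∀ n, eLpNorm (gn n) 2 (SingularODE.mu L) ≤ ENNReal.ofReal C)
    (hgng : SingularODE.WeakTendstoL2 L gn g)
    (hφn : ∀ n, Continuous (φn n))
    (hφnφ : SingularODE.IsReasonableApprox (fun n s => (φn n s : EReal)) φ)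
    -- solutions of the approximating problems
    (un dun : ℕ → ℝ → ℝ)
    (hun : ∀ n, SingularODE.IsWeakSolution L (an n) (gn n) (φn n) (un n) (dun n)) :
    -- the constants `c n` in `a_n u_n' = φ_n(u_n) + g_n + c_n` exist and are unique
    (∀ n, ∃! c : ℝ, SingularODE.EqDistrib L (fun x => an n x * dun n x)
      (fun x => φn n (un n x) + gn n x + c)) ∧
    ∀ c : ℕ → ℝ,
      (∀ n, SingularODE.EqDistrib L (fun x => an n x * dun n x)
        (fun x => φn n (un n x) + gn n x + c n)) →
      -- a subsequence along which `u_n` converges weakly to `u` and `c_n` to `ct`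
      ∀ (σ : ℕ → ℕ), StrictMono σ →
      ∀ (u du : ℝ → ℝ),
        SingularODE.WeakTendstoH10 L (fun k => un (σ k)) (fun k => dun (σ k)) u du →
      ∀ ct : EReal, Tendsto (fun k => ((c (σ k) : ℝ) : EReal)) atTop (𝓝 ct) →
        List.TFAE
          [ ∀ x ∈ Icc 0 L, u x = 0,
            ct = ⊥,
            ∀ M : ℝ, ∀ᶠ k in atTop, ∀ x ∈ Ioo 0 L, M ≤ φn (σ k) (un (σ k) x),
            Tendsto (fun p : ℕ × ℝ => φn (σ p.1) (un (σ p.1) p.2))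
              (atTop ×ˢ 𝓟 (Icc 0 L)) atTop ] ∧
        List.TFAE
          [ ¬ ∀ x ∈ Icc 0 L, u x = 0,
            ⊥ < ct ∧ ct < ⊤,
            SingularODE.WeakTendstoL2Ext L (fun k x => φn (σ k) (un (σ k) x))
              (fun x => φ (u x)) ] ∧
        ct ≠ ⊤ := by
  obtain ⟨α, β, hA⟩ := han
  obtain ⟨Cg, hCg, hgb⟩ := hgn
  have hgm : ∀ n, MemLp (gn n) 2 (SingularODE.mu L) := hgng.1
  refine ⟨fun n => (hun n).existsUnique_const hL (hA n) (hgm n) (hφn n), ?_⟩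
  intro c hc σ hσ u du hu ct hct
  obtain ⟨K₀, hK₀, hdu⟩ := hu.exists_bound hL
  have hβ : 0 ≤ β := ((hA 0).pos.trans (hA 0).lt).le
  set K := β * K₀ + Cg
  have hK : 0 ≤ K := by positivity
  set f : ℕ → ℝ → ℝ := fun k x => φn (σ k) (un (σ k) x)
  have hf : ∀ k, MemLp (f k) 2 (SingularODE.mu L) := fun k =>
    SingularODE.memLp_of_continuousOn ((hφn _).comp_continuousOn (hun _).1.continuousOn)
  have hfK : ∀ k, eLpNorm (fun x => f k x + c (σ k)) 2 (SingularODE.mu L) ≤ ENNReal.ofReal K :=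
    fun k => SingularODE.IsWeakSolution.eLpNorm_add_const_le (φ := φn (σ k)) (u := un (σ k))
      (hA _) (hgm _) (hφn _) (hun _) (hc _) hK₀ (hdu k) hCg.le (hgb _)
  have hconv : ∀ x ∈ Icc 0 L, Tendsto (fun p : ℕ × ℝ => (f p.1 p.2 : EReal))
      (atTop ×ˢ 𝓝[Icc 0 L] x) (𝓝 (φ (u x))) := fun x hx =>
    (hφnφ.tendsto_prod (u x)).comp
      ((hσ.tendsto_atTop.comp tendsto_fst).prodMk (hu.tendsto_prod hL hx))
  have hpt : ∀ x ∈ Icc 0 L, Tendsto (fun k => (f k x : EReal)) atTop (𝓝 (φ (u x))) := fun x hx =>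
    (hconv x hx).comp (tendsto_id.prodMk
      (tendsto_const_pure.mono_right (pure_le_nhdsWithin hx)))
  have htop : ct ≠ ⊤ := by
    obtain ⟨M, hM⟩ := SingularODE.exists_lower_bound (F := fun x => φ (u x))
      (fun x => hφ.ne_bot (u x)) hconv
    have : ct ≤ ((K * √(L - 0) / (L - 0) - M : ℝ) : EReal) := by
      refine le_of_tendsto hct (hM.mono fun k hk => EReal.coe_le_coe_iff.2 ?_)
      exact SingularODE.le_of_forall_add_le (hf k) hK (hfK k) le_rfl le_rfl hL
        fun t ht => hk t (Ioo_subset_Icc_self ht)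
    exact (this.trans_lt (EReal.coe_lt_top _)).ne
  have h1 : List.TFAE
      [ ∀ x ∈ Icc 0 L, u x = 0,
        ct = ⊥,
        ∀ M : ℝ, ∀ᶠ k in atTop, ∀ x ∈ Ioo 0 L, M ≤ f k x,
        Tendsto (fun p : ℕ × ℝ => f p.1 p.2) (atTop ×ˢ 𝓟 (Icc 0 L)) atTop ] := by
    tfae_have 1 → 4 := by
      intro h0
      refine tendsto_atTop.2 fun M => eventually_prod_principal_iff.2 ?_
      refine SingularODE.eventually_forall_mem_of_prod isCompact_Icc fun x hx => ?_
      have := hconv x hx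
      rw [h0 x hx, hφ0, EReal.tendsto_coe_nhds_top_iff] at this
      exact this.eventually_ge_atTop M
    tfae_have 4 → 3 := by
      intro h M
      have := eventually_prod_principal_iff.1 (h.eventually_ge_atTop M)
      exact this.mono fun k hk x hx => hk x (Ioo_subset_Icc_self hx)
    tfae_have 3 → 2 := by
      intro h
      refine tendsto_nhds_unique hct
        (EReal.tendsto_coe_nhds_bot_iff.2 (tendsto_atBot.2 fun b => ?_))
      filter_upwards [h (K * √(L - 0) / (L - 0) - b)] with k hk
      have := SingularODE.le_of_forall_add_le (hf k) hK (hfK k) le_rfl le_rfl hL hk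
      linarith
    -- If `u x ≠ 0`, then `φ (u x)` is finite and `f k` stays below some `M` on an interval to the
    -- right of `x` for large `k`; this bounds `c (σ k)` below.
    tfae_have 2 → 1 := by
      intro hbot x hx
      by_contra hne
      have hxL : x < L := lt_of_le_of_ne hx.2 fun h => hne (h ▸ hu.2.1.right)
      obtain ⟨M, hM, -⟩ := EReal.lt_iff_exists_real_btwn.1
        (lt_top_iff_ne_top.2 (hφ.finite _ hne))
      obtain ⟨pa, ha', pb, hb', hab⟩ :=
        eventually_prod_iff.1 ((hconv x hx).eventually (gt_mem_nhds hM))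
      have hIcc : Icc 0 L ∈ 𝓝[>] x := mem_of_superset (Ioo_mem_nhdsGT hxL)
        fun y hy => ⟨hx.1.trans hy.1.le, hy.2.le⟩
      have hb2 : {y | pb y} ∈ 𝓝[>] x := nhdsWithin_le_of_mem hIcc hb'
      obtain ⟨y, hy, hyb⟩ := (mem_nhdsGT_iff_exists_Ioo_subset' hxL).1 hb2
      -- The endpoint `y` may exceed `L`, hence the truncation.
      have hxz : x < min y L := lt_min hy hxL
      have : ((-(K * √(min y L - x) / (min y L - x)) - M : ℝ) : EReal) ≤ ct := by
        refine ge_of_tendsto hct (ha'.mono fun k hk => EReal.coe_le_coe_iff.2 ?_)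
        refine SingularODE.le_of_forall_le_add (hf k) hK (hfK k) hx.1 (min_le_right _ _) hxz
          fun t ht => ?_
        exact (EReal.coe_lt_coe_iff.1
          (hab hk (hyb ⟨ht.1, ht.2.trans_le (min_le_left _ _)⟩))).le
      rw [hbot] at this
      exact (EReal.bot_lt_coe _).not_ge this
    tfae_finish
  refine ⟨h1, ?_, htop⟩
  have h12 := h1.out 0 1
  tfae_have 1 ↔ 2 := by
    rw [h12, lt_top_iff_ne_top, bot_lt_iff_ne_bot]
    exact ⟨fun h => ⟨h, htop⟩, fun h => h.1⟩
  tfae_have 2 → 3 := by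
    rintro ⟨hb, ht⟩
    lift ct to ℝ using ⟨ht.ne, hb.ne'⟩
    obtain ⟨B, hB⟩ := ((EReal.tendsto_coe.1 hct).abs).bddAbove_range
    have hB0 : ∀ k, |c (σ k)| ≤ B := fun k => hB (mem_range_self k)
    have hfin : eLpNorm (fun _ : ℝ => B) 2 (SingularODE.mu L) ≠ ⊤ := (memLp_const B).2.ne
    refine SingularODE.weakTendstoL2Ext_of_ae
      (K := K + (eLpNorm (fun _ : ℝ => B) 2 (SingularODE.mu L)).toReal) hf (fun k => ?_) ?_
    -- The sum is bounded by the flux and the constants converge, so `f k` itself is bounded in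
    -- `L²`.
    · have e : f k = (fun x => f k x + c (σ k)) - fun _ => c (σ k) := by
        ext x
        simp
      rw [e, ENNReal.ofReal_add hK ENNReal.toReal_nonneg, ENNReal.ofReal_toReal hfin]
      refine (eLpNorm_sub_le ((hf k).add (memLp_const _)).1 aestronglyMeasurable_const
        (by norm_num)).trans (add_le_add (hfK k) (eLpNorm_mono fun x => ?_))
      exact (hB0 k).trans (le_abs_self B)
    · exact SingularODE.ae_mu_iff.2 (Eventually.of_forall fun x hx =>
        hpt x (Ioo_subset_Icc_self hx))
  tfae_have 3 → 1 := by
    intro h h0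
    have : NeBot (ae (SingularODE.mu L)) := ae_neBot.2 (SingularODE.mu_ne_zero hL)
    have hmem : ∀ᵐ x ∂(SingularODE.mu L), x ∈ Ioo 0 L :=
      SingularODE.ae_mu_iff.2 (Eventually.of_forall fun x hx => hx)
    obtain ⟨x, hx, hx'⟩ := (h.1.and hmem).exists
    exact hx.1 ((congrArg φ (h0 x (Ioo_subset_Icc_self hx'))).trans hφ0)
  tfae_finish
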